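/- Let $V$ be a finite set of random variables; each $v\in V$ takes values in a measurable space $E_v$ with a $\sigma$-finite reference measure $\mu_v$, and all densities are taken with respect to product reference measures (identities between densities hold almost everywhere). A family of interventional densities consists of probability densities $f(v\mid do(x))$, one for each $\mathbf X\subseteq V$ and each value $x$ of $\mathbf X$, whose observational member $f(v)$ ($\mathbf X=\emptyset$) is positive; $f(y\mid do(x))$ is its marginal in $\mathbf Y$. The family is *compatible* with a directed acyclic graph $D$ on $V$ if for every $\mathbf X\subseteq V$ $$f(v\mid do(x))=\prod_{V_i\in V\setminus\mathbf X} f(v_i\mid \mathrm{pa}(v_i,D))\,\mathbf 1(v_{\mathbf X}=x).$$ A density $f$ is *faithful* to $D$ if, for pairwise disjoint $A,B,C\subseteq V$, conditional independence of $A$ and $B$ given $C$ under $f$ implies that $A$ and $B$ are d-separated given $C$ in $D$. A *causal model* induces a directed acyclic graph $D$ on $V$ and a family of interventional densities compatible with $D$ whose observational density $f(v)$ is faithful to $D$; $V$ may contain unobserved variables. Let $\mathbf X=\{X_1,\dots,X_k\}$, $k\ge 1$ (with $X_1,\dots,X_k$ distinct), $\{Y\}$ and $\mathbf W$ be pairwise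 disjoint sets of (observed) variables in a causal model with graph $D$. Suppose that $\mathbf W<X_1<\dots<X_k<Y$ is a causal ordering consistent with the model: no later variable is an ancestor in $D$ of an earlier one (no order is imposed inside $\mathbf W$; every node counts as an ancestor of itself). Suppose that there are $W_1,\dots,W_k\in\mathbf W$ and $\mathbf Z\subseteq\mathbf W\setminus\{W_1,\dots,W_k\}$ such that, for every $i\in\{1,\dots,k\}$, under the observational density $f(v)$ of the model, (i) $W_i$ and $Y$ are not conditionally independent given $\mathbf Z\cup\{X_1,\dots,X_{i-1}\}$, and (ii) $W_i$ and $Y$ are conditionally independent given $\mathbf Z\cup\{X_1,\dots,X_i\}$. Then $\mathbf X$ has a causal effect on $Y$ that is identifiable through the adjustment set $\mathbf Z$. That is: (a) for every $i$ there is a directed path $X_i\to\dots\to Y$ in $D$; (b) the causal effect of $\mathbf X$ on $Y$ is identifiable in $D$: any two families of interventional densities compatible with $D$ that have the same observational density have the same $f(y\mid do(x))$; (c) $\mathbf Z$ is an adjustment set relative to $(\mathbf X,Y)$ in $D$: for every family of interventional densities compatible with $D$ (over any state spaces and any $\sigma$-finite reference measures), $$f(y\mid do(x))=\int f(y\mid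 x,z)\,f(z)\,dz .$$ -/

import Mathlib

open MeasureTheory
open scoped ENNReal

universe u

namespace CausalDAG

section Graph

variable {V : Type*}

/-- `a` is an ancestor of `b` (every node is an ancestor of itself). -/
def IsAncestor (G : Digraph V) (a b : V) : Prop :=
  Relation.ReflTransGen G.Adj a b

/-- `a` has a causal effect on `b`: there is a directed path `a → ⋯ → b` with at least one edge. -/
def HasCausalEffect (G : Digraph V) (a b : V) : Prop :=
  Relation.TransGen G.Adj a b

/-- There is no directed cycle. -/
def IsAcyclic (G : Digraph V) : Prop :=
  ∀ v, ¬ Relation.TransGen G.Adj v v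

open Classical in
/-- The set of parents of a node. -/
noncomputable def parents [Fintype V] (G : Digraph V) (v : V) : Finset V :=
  Finset.univ.filter fun u => G.Adj u v

/-- `p` is a path from `a` to `b`: a sequence of distinct nodes in which successive nodes are
joined by an edge, in either direction. -/
structure IsPath (G : Digraph V) (a b : V) (p : List V) : Prop where
  nodup : p.Nodup
  chain : p.IsChain fun s t => G.Adj s t ∨ G.Adj t s
  head : p.head? = some a
  last : p.getLast? = some b

/-- The path `p` is open given `C`: each interior node `m`, with neighbours `s` and `t` on `p`, has
a descendant in `C` if it is a collider `s → m ← t`, and does not lie in `C` otherwise. -/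
def IsOpen (G : Digraph V) (C : Finset V) (p : List V) : Prop :=
  ∀ s m t : V, [s, m, t] <:+: p →
    ((G.Adj s m ∧ G.Adj t m) → ∃ d ∈ C, IsAncestor G m d) ∧
    (¬ (G.Adj s m ∧ G.Adj t m) → m ∉ C)

/-- `A` and `B` are d-separated given `C`. -/
def DSep (G : Digraph V) (A B C : Finset V) : Prop :=
  ∀ a ∈ A, ∀ b ∈ B, ∀ p : List V, IsPath G a b p → ¬ IsOpen G C p

/-- The blocks of the list `L` form a causal ordering: no node of a later block is an ancestor of
a node of an earlier block. -/
def IsCausalOrdering (G : Digraph V) (L : List (Finset V)) : Prop :=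
  L.Pairwise fun A B => ∀ a ∈ A, ∀ b ∈ B, ¬ IsAncestor G b a

end Graph

section Density

variable {V : Type*} [Fintype V] [DecidableEq V] {E : V → Type u} [∀ v, MeasurableSpace (E v)]

/-- The marginal density of the variables in `S`. It is a function of the whole configuration that
depends only on the coordinates in `S`; the other coordinates are integrated out. -/
noncomputable def marg (μ : ∀ v, Measure (E v)) (f : (∀ v, E v) → ℝ≥0∞) (S : Finset V) :
    (∀ v, E v) → ℝ≥0∞ :=
  ∫⋯∫⁻_Sᶜ, f ∂μ

/-- The conditional density `f(a | b) = f(a, b) / f(b)` of the variables in `A` given those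
in `B`. -/
noncomputable def condDens (μ : ∀ v, Measure (E v)) (f : (∀ v, E v) → ℝ≥0∞) (A B : Finset V) :
    (∀ v, E v) → ℝ≥0∞ :=
  fun v => marg μ f (A ∪ B) v / marg μ f B v

/-- Conditional independence of `A` and `B` given `C` under the density `f`:
`f(a, b, c) f(c) = f(a, c) f(b, c)` almost everywhere. -/
def CondIndep (μ : ∀ v, Measure (E v)) (f : (∀ v, E v) → ℝ≥0∞) (A B C : Finset V) : Prop :=
  ∀ᵐ v ∂Measure.pi μ,
    marg μ f (A ∪ B ∪ C) v * marg μ f C v = marg μ f (A ∪ C) v * marg μ f (B ∪ C) v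

/-- `f` is faithful to `G`: conditional independence implies d-separation. -/
def IsFaithful (G : Digraph V) (μ : ∀ v, Measure (E v)) (f : (∀ v, E v) → ℝ≥0∞) : Prop :=
  ∀ A B C : Finset V, Disjoint A B → Disjoint A C → Disjoint B C →
    CondIndep μ f A B C → DSep G A B C

/-- A family of interventional densities `f(v | do(x))`, one for each set `X` of variables and each
value `x`. The density `f(· | do(x))` is concentrated on the configurations `v` with `v_X = x`, and
on those it is a density in the remaining coordinates; so it is recorded as `dens X v`, where the
coordinates of `v` in `X` are the value `x`. The observational density is `dens ∅`; it is
positive. -/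
structure InterventionalFamily (μ : ∀ v, Measure (E v)) where
  dens : Finset V → (∀ v, E v) → ℝ≥0∞
  measurable_dens : ∀ X, Measurable (dens X)
  normalized : ∀ X v, (∫⋯∫⁻_Xᶜ, dens X ∂μ) v = 1
  pos : ∀ᵐ v ∂Measure.pi μ, 0 < dens ∅ v

/-- The observational density. -/
def InterventionalFamily.obs {μ : ∀ v, Measure (E v)} (F : InterventionalFamily μ) :
    (∀ v, E v) → ℝ≥0∞ :=
  F.dens ∅

/-- The interventional density `f(y | do(x))` of the variables in `Y`, as a function of the
coordinates in `X ∪ Y`. -/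
noncomputable def InterventionalFamily.doDens {μ : ∀ v, Measure (E v)}
    (F : InterventionalFamily μ) (X Y : Finset V) : (∀ v, E v) → ℝ≥0∞ :=
  ∫⋯∫⁻_(X ∪ Y)ᶜ, F.dens X ∂μ

/-- `G` is a causal Bayesian network compatible with `F`: the truncated factorization
`f(v | do(x)) = ∏_{i ∉ X} f(v_i | pa(v_i))` (on `v_X = x`) holds for every `X`. For `X = ∅` this is
Markov compatibility of the observational density with `G`. -/
def IsCompatible (G : Digraph V) {μ : ∀ v, Measure (E v)} (F : InterventionalFamily μ) : Prop :=
  ∀ X : Finset V, ∀ᵐ v ∂Measure.pi μ,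
    F.dens X v = ∏ i ∈ Xᶜ, condDens μ F.obs {i} (parents G i) v

/-- A causal model with variables `V`, where the variable `v` takes values in `E v` and densities
are taken with respect to the reference measures `μ v`: the induced DAG, and the induced
interventional densities, which are consistent with the DAG and whose observational member is
faithful to it. -/
structure CausalModel (μ : ∀ v, Measure (E v)) where
  graph : Digraph V
  acyclic : IsAcyclic graph
  family : InterventionalFamily μ
  compatible : IsCompatible graph family
  faithful : IsFaithful graph μ family.obs

end Density

section Adjustment

variable {V : Type*} [Fintype V] [DecidableEq V]

/-- `Z` is an adjustment set relative to `(X, Y)` in `G`: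
`f(y | do(x)) = ∫ f(y | x, z) f(z) dz` for all densities `f` consistent with `G`, over any state
spaces and any σ-finite reference measures. -/
def IsAdjustmentSet (G : Digraph V) (X Y Z : Finset V) : Prop :=
  ∀ (E : V → Type u) [∀ v, MeasurableSpace (E v)] (μ : ∀ v, Measure (E v))
    [∀ v, SigmaFinite (μ v)] (F : InterventionalFamily μ), IsCompatible G F →
    ∀ᵐ v ∂Measure.pi μ,
      F.doDens X Y v =
        (∫⋯∫⁻_Z, (fun w => condDens μ F.obs Y (X ∪ Z) w * marg μ F.obs Z w) ∂μ) v

/-- The causal effect of `X` on `Y` is identifiable in `G`: two compatible families with the same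
observational density have the same `f(y | do(x))`. -/
def IsIdentifiable (G : Digraph V) (X Y : Finset V) : Prop :=
  ∀ (E : V → Type u) [∀ v, MeasurableSpace (E v)] (μ : ∀ v, Measure (E v))
    [∀ v, SigmaFinite (μ v)] (F₁ F₂ : InterventionalFamily μ),
    IsCompatible G F₁ → IsCompatible G F₂ →
    (∀ᵐ v ∂Measure.pi μ, F₁.obs v = F₂.obs v) →
    ∀ᵐ v ∂Measure.pi μ, F₁.doDens X Y v = F₂.doDens X Y v

end Adjustment

end CausalDAG

/- Condition (ii) blocks an open path from `w i` to `Y` by conditioning on `X i` as well, so `X i`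
is a non-collider on that path. Since `X i` is an ancestor neither of `w i` nor of the conditioning
set, the path enters `X i` from `w i` and leaves it as a directed path to `Y`. If there were an open
back-door path from `X i` to `Y` given `Z`, it could be glued to the first part of that path at the
collider `X i`, which contradicts (ii). Hence `Z` separates `X` from `Y` once the edges leaving `X`
are removed.

For the densities, let `S` be the set of relevant nodes from which `Y` can still be reached given
`Z`. No factor of the Markov factorization mixes `S` with nodes outside `S ∪ X ∪ Z`, and the factors
of the nodes of `X` do not involve `S`. So the intervention leaves all the factors involving `S`
unchanged, which gives `f(y | do(x), z) = f(y | x, z)`; and `f(z | do(x)) = f(z)` because no node of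
`X` is an ancestor of `Z`. -/

namespace CausalDAG

section Walks

variable {V : Type*} {G : Digraph V} {C : Finset V}

/-- The condition that `IsOpen` imposes on an interior node `m` with neighbours `s` and `t`. -/
def IsOpenAt (G : Digraph V) (C : Finset V) (s m t : V) : Prop :=
  ((G.Adj s m ∧ G.Adj t m) → ∃ d ∈ C, IsAncestor G m d) ∧
    (¬ (G.Adj s m ∧ G.Adj t m) → m ∉ C)

theorem IsOpenAt.symm {s m t : V} (h : IsOpenAt G C s m t) : IsOpenAt G C t m s :=
  ⟨fun hc => h.1 hc.symm, fun hc => h.2 fun hc' => hc hc'.symm⟩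

theorem isOpenAt_of_not_adj {s m t : V} (h : ¬ (G.Adj s m ∧ G.Adj t m)) (hm : m ∉ C) :
    IsOpenAt G C s m t :=
  ⟨fun hc => absurd hc h, fun _ => hm⟩

theorem isOpenAt_of_adj {s m t : V} (hs : G.Adj s m) (ht : G.Adj t m)
    (hm : ∃ d ∈ C, IsAncestor G m d) : IsOpenAt G C s m t :=
  ⟨fun _ => hm, fun h => absurd ⟨hs, ht⟩ h⟩

theorem IsOpenAt.eq_of_not_isOpenAt_insert [DecidableEq V] {s m t x : V} (h : IsOpenAt G C s m t)
    (h' : ¬ IsOpenAt G (insert x C) s m t) : m = x ∧ ¬ (G.Adj s m ∧ G.Adj t m) := by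
  by_cases hc : G.Adj s m ∧ G.Adj t m
  · obtain ⟨d, hd, hmd⟩ := h.1 hc
    exact absurd (isOpenAt_of_adj hc.1 hc.2 ⟨d, Finset.mem_insert_of_mem hd, hmd⟩) h'
  · refine ⟨?_, hc⟩
    by_contra hmx
    exact h' (isOpenAt_of_not_adj hc (by simp [hmx, h.2 hc]))

theorem isOpen_of_length_le_two {p : List V} (hp : p.length ≤ 2) : IsOpen G C p := by
  intro s m t h
  have := h.length_le
  simp only [List.length_cons, List.length_nil] at this
  omega

theorem IsOpen.of_infix {p q : List V} (hq : IsOpen G C q) (h : p <:+: q) : IsOpen G C p :=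
  fun s m t hs => hq s m t (hs.trans h)

theorem IsOpen.reverse {p : List V} (h : IsOpen G C p) : IsOpen G C p.reverse := fun s m t hsmt =>
  IsOpenAt.symm (h t m s (by simpa using List.reverse_infix.2 hsmt))

theorem isOpen_cons_cons_cons {s m t : V} {l : List V} :
    IsOpen G C (s :: m :: t :: l) ↔ IsOpenAt G C s m t ∧ IsOpen G C (m :: t :: l) := by
  refine ⟨fun h => ⟨h s m t ⟨[], l, by simp⟩, h.of_infix ⟨[s], [], by simp⟩⟩, ?_⟩
  rintro ⟨hm, h⟩ a b c habc
  rcases List.infix_cons_iff.1 habc with hpre | hinf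
  · simp only [List.cons_prefix_cons] at hpre
    obtain ⟨rfl, rfl, rfl, -⟩ := hpre
    exact hm
  · exact h a b c hinf

theorem isOpen_append_cons_cons {s m : V} {l₁ l₂ : List V} :
    IsOpen G C (l₁ ++ s :: m :: l₂) ↔
      IsOpen G C (l₁ ++ [s, m]) ∧ IsOpen G C (s :: m :: l₂) := by
  induction l₁ with
  | nil => simp [isOpen_of_length_le_two]
  | cons a l ih =>
    rcases l with _ | ⟨b, _ | ⟨c, l⟩⟩ <;>
      simp_all [isOpen_cons_cons_cons, isOpen_of_length_le_two, and_assoc]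

theorem IsOpen.insert_of_nodup [DecidableEq V] {x : V} {l : List V} (hnd : (l ++ [x]).Nodup)
    (h : IsOpen G C (l ++ [x])) : IsOpen G (insert x C) (l ++ [x]) := by
  intro s m t hsmt
  by_contra hm
  obtain ⟨rfl, -⟩ := IsOpenAt.eq_of_not_isOpenAt_insert (h s m t hsmt) hm
  obtain ⟨u, v, huv⟩ := hsmt
  have hsplit : l ++ m :: [] = (u ++ [s]) ++ m :: t :: v := by simpa using huv.symm
  have hml : m ∉ l := fun hml => (List.nodup_append.1 hnd).2.2 m hml m (by simp) rfl
  exact absurd ((List.append_cons_inj_of_notMem hml (by simp)).1 hsplit).2.2 (by simp)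

/-- `p` is a walk from `a` to `b` that is open given `C`. In contrast to `IsPath`, nodes may be
repeated, so open walks can be concatenated. -/
structure IsOpenWalk (G : Digraph V) (C : Finset V) (a b : V) (p : List V) : Prop where
  chain : p.IsChain fun s t => G.Adj s t ∨ G.Adj t s
  head : p.head? = some a
  last : p.getLast? = some b
  isOpen : IsOpen G C p

theorem IsPath.isOpenWalk {a b : V} {p : List V} (h : IsPath G a b p) (ho : IsOpen G C p) :
    IsOpenWalk G C a b p :=
  ⟨h.chain, h.head, h.last, ho⟩

namespace IsOpenWalk

variable {a b c m : V} {p l l₁ l₂ : List V}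

theorem singleton (a : V) : IsOpenWalk G C a a [a] :=
  ⟨by simp, rfl, rfl, isOpen_of_length_le_two (by simp)⟩

theorem reverse (h : IsOpenWalk G C a b p) : IsOpenWalk G C b a p.reverse where
  chain := List.isChain_reverse.2 (h.chain.imp fun _ _ => Or.symm)
  head := by simpa using h.last
  last := by simpa using h.head
  isOpen := h.isOpen.reverse

theorem exists_eq_cons (h : IsOpenWalk G C a b p) : ∃ l, p = a :: l :=
  List.head?_eq_some_iff.1 h.head

theorem cons (h : IsOpenWalk G C a b (a :: l)) (hadj : G.Adj c a ∨ G.Adj a c)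
    (ha : ∀ t ∈ l.head?, IsOpenAt G C c a t) : IsOpenWalk G C c b (c :: a :: l) where
  chain := List.isChain_cons_cons.2 ⟨hadj, h.chain⟩
  head := rfl
  last := by simpa using h.last
  isOpen := by
    rcases l with _ | ⟨t, l⟩
    · exact isOpen_of_length_le_two (by simp)
    · exact isOpen_cons_cons_cons.2 ⟨ha t (by simp), h.isOpen⟩

theorem left_of_append (h : IsOpenWalk G C a b (l₁ ++ m :: l₂)) :
    IsOpenWalk G C a m (l₁ ++ [m]) where
  chain := (List.isChain_split.1 h.chain).1
  head := by simpa [List.head?_append] using h.head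
  last := by simp
  isOpen := h.isOpen.of_infix ⟨[], l₂, by simp⟩

theorem right_of_append (h : IsOpenWalk G C a b (l₁ ++ m :: l₂)) :
    IsOpenWalk G C m b (m :: l₂) where
  chain := (List.isChain_split.1 h.chain).2
  head := rfl
  last := by simpa [List.getLast?_append] using h.last
  isOpen := h.isOpen.of_infix ⟨l₁, [], by simp⟩

theorem append {s t : V} (h₁ : IsOpenWalk G C a m (l₁ ++ [s, m]))
    (h₂ : IsOpenWalk G C m b (m :: t :: l₂)) (hm : IsOpenAt G C s m t) :
    IsOpenWalk G C a b (l₁ ++ s :: m :: t :: l₂) where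
  chain := by
    have := List.isChain_append_cons_cons.1 h₁.chain
    exact List.isChain_append_cons_cons.2 ⟨this.1, this.2.1, h₂.chain⟩
  head := by simpa [List.head?_append] using h₁.head
  last := by simpa [List.getLast?_append, List.getLast?_cons] using h₂.last
  isOpen := isOpen_append_cons_cons.2 ⟨h₁.isOpen, isOpen_cons_cons_cons.2 ⟨hm, h₂.isOpen⟩⟩

/- A walk that starts along `a → t` can only turn at a collider, which would be a descendant of
`a` with a descendant in `C`. -/
theorem transGen_of_adj {t : V} (h : IsOpenWalk G C a b (a :: t :: l)) (hadj : G.Adj a t)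
    (ha : ∀ d ∈ C, ¬ IsAncestor G a d) : Relation.TransGen G.Adj a b := by
  induction l generalizing a t with
  | nil =>
    obtain rfl : t = b := by simpa using h.last
    exact .single hadj
  | cons u l ih =>
    have ht : ∀ d ∈ C, ¬ IsAncestor G t d := fun d hd htd => ha d hd (.head hadj htd)
    have hut : ¬ G.Adj u t := fun hut => by
      obtain ⟨d, hd, htd⟩ := (isOpen_cons_cons_cons.1 h.isOpen).1.1 ⟨hadj, hut⟩
      exact ht d hd htd
    have htail : IsOpenWalk G C t b (t :: u :: l) := h.right_of_append (l₁ := [a])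
    exact .head hadj (ih htail ((List.isChain_cons_cons.1 htail.chain).1.resolve_right hut) ht)

end IsOpenWalk

theorem IsAcyclic.not_adj (hG : IsAcyclic G) {a b : V} (h : G.Adj a b) : ¬ G.Adj b a :=
  fun h' => hG a (.tail (.single h) h')

theorem isOpenAt_of_adj_left (hG : IsAcyclic G) {s m t : V} (h : G.Adj m s) (hm : m ∉ C) :
    IsOpenAt G C s m t :=
  isOpenAt_of_not_adj (fun hc => hG.not_adj h hc.1) hm

namespace IsOpenWalk

variable {a b c m : V} {p : List V}

theorem exists_of_isAncestor (hG : IsAcyclic G) (h : IsOpenWalk G C a b p)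
    (hac : IsAncestor G a c) (ha : ∀ d ∈ C, ¬ IsAncestor G a d) : ∃ q, IsOpenWalk G C c b q := by
  induction hac with
  | refl => exact ⟨p, h⟩
  | @tail x y hax hxy ih =>
    obtain ⟨q, hq⟩ := ih
    obtain ⟨l, rfl⟩ := hq.exists_eq_cons
    exact ⟨_, hq.cons (Or.inr hxy) fun t _ =>
      isOpenAt_of_adj_left hG hxy fun hxC => ha x hxC hax⟩

/- If `m` becomes a collider when the loop is cut out, then either it was one before, or the loop
leaves `m` along an outgoing edge and, since it cannot be a directed cycle, `m` is an ancestor of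
`C`. -/
theorem isOpenAt_of_loop (hG : IsAcyclic G) {s s' t t' : V} {l : List V}
    (hloop : IsOpenWalk G C m m (m :: s' :: l)) (hs : IsOpenAt G C s m s')
    (ht : IsOpenAt G C t' m t) : IsOpenAt G C s m t := by
  constructor
  · rintro ⟨hsm, -⟩
    by_cases hs'm : G.Adj s' m
    · exact hs.1 ⟨hsm, hs'm⟩
    · by_contra! hm
      exact hG m (hloop.transGen_of_adj
        ((List.isChain_cons_cons.1 hloop.chain).1.resolve_right hs'm) hm)
  · intro hc
    by_cases hsm : G.Adj s m
    · exact ht.2 fun h => hc ⟨hsm, h.2⟩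
    · exact hs.2 fun h => hsm h.1

theorem remove_loop (hG : IsAcyclic G) {l₁ l₂ l₃ : List V}
    (h : IsOpenWalk G C a b (l₁ ++ m :: (l₂ ++ m :: l₃))) :
    IsOpenWalk G C a b (l₁ ++ m :: l₃) := by
  have hfst : IsOpenWalk G C a m (l₁ ++ [m]) := h.left_of_append
  have htail : IsOpenWalk G C m b (m :: l₂ ++ m :: l₃) := h.right_of_append
  have hlst : IsOpenWalk G C m b (m :: l₃) := htail.right_of_append
  have hloop : IsOpenWalk G C m m (m :: (l₂ ++ [m])) := htail.left_of_append
  rcases l₁.eq_nil_or_concat' with rfl | ⟨l₁, s, rfl⟩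
  · obtain rfl : m = a := by simpa using hfst.head
    exact hlst
  rcases l₃ with _ | ⟨t, l₃⟩
  · obtain rfl : m = b := by simpa using hlst.last
    exact hfst
  obtain ⟨s', l, hs'⟩ := List.exists_cons_of_ne_nil (l := l₂ ++ [m]) (by simp)
  obtain ⟨l', t', ht'⟩ := (List.eq_nil_or_concat' (m :: l₂)).resolve_left (by simp)
  have hs : IsOpenAt G C s m s' := h.isOpen s m s' ⟨l₁, l ++ t :: l₃, by
    rw [show l₂ ++ m :: t :: l₃ = (l₂ ++ [m]) ++ t :: l₃ by simp, hs']
    simp⟩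
  have ht : IsOpenAt G C t' m t := htail.isOpen t' m t ⟨l', l₃, by rw [ht']; simp⟩
  rw [hs'] at hloop
  rw [List.append_assoc] at hfst ⊢
  exact hfst.append hlst (isOpenAt_of_loop hG hloop hs ht)

theorem exists_isPath (hG : IsAcyclic G) (h : IsOpenWalk G C a b p) :
    ∃ q, IsPath G a b q ∧ IsOpen G C q := by
  induction hn : p.length using Nat.strong_induction_on generalizing p with
  | _ n ih =>
    by_cases hp : p.Nodup
    · exact ⟨p, ⟨hp, h.chain, h.head, h.last⟩, h.isOpen⟩
    · obtain ⟨m, hm⟩ := List.exists_duplicate_iff_not_nodup.2 hp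
      obtain ⟨q, r, rfl, hmq, hmr⟩ := List.cons_sublist_iff.1 (List.duplicate_iff_sublist.1 hm)
      obtain ⟨l₁, l₂, rfl⟩ := List.append_of_mem hmq
      obtain ⟨l₃, l₄, rfl⟩ := List.append_of_mem (List.singleton_sublist.1 hmr)
      have hcut : IsOpenWalk G C a b (l₁ ++ m :: l₄) :=
        remove_loop (l₂ := l₂ ++ l₃) hG (by simpa using h)
      refine ih _ ?_ hcut rfl
      simp only [List.length_append, List.length_cons] at hn ⊢
      omega

end IsOpenWalk

theorem DSep.not_isOpenWalk (hG : IsAcyclic G) {A B : Finset V} (h : DSep G A B C) {a b : V}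
    (ha : a ∈ A) (hb : b ∈ B) (p : List V) : ¬ IsOpenWalk G C a b p := by
  intro hp
  obtain ⟨q, hq, hq'⟩ := hp.exists_isPath hG
  exact h a ha b hb q hq hq'

end Walks

section Separation

variable {V : Type*} [Fintype V] {G : Digraph V} {A B C S : Finset V}

theorem mem_parents {u v : V} : u ∈ parents G v ↔ G.Adj u v := by simp [parents]

theorem IsAcyclic.exists_disjoint_parents (hG : IsAcyclic G) (hS : S.Nonempty) :
    ∃ s ∈ S, Disjoint (parents G s) S := by
  have : Std.Irrefl (Relation.TransGen G.Adj) := ⟨hG⟩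
  have hwf : WellFounded (Relation.TransGen G.Adj) := Finite.wellFounded_of_trans_of_irrefl _
  obtain ⟨s, hs, hmin⟩ := hwf.has_min (S : Set V) hS
  exact ⟨s, hs, Finset.disjoint_left.2 fun u hu huS => hmin u huS (.single (mem_parents.1 hu))⟩

open Classical in
/-- The ancestral closure of `S`: the nodes that are ancestors of a node in `S`. -/
noncomputable def ancestors (G : Digraph V) (S : Finset V) : Finset V :=
  Finset.univ.filter fun v => ∃ s ∈ S, IsAncestor G v s

theorem mem_ancestors {v : V} : v ∈ ancestors G S ↔ ∃ s ∈ S, IsAncestor G v s := by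
  simp [ancestors]

theorem subset_ancestors (G : Digraph V) (S : Finset V) : S ⊆ ancestors G S :=
  fun s hs => mem_ancestors.2 ⟨s, hs, .refl⟩

/-- `T` is an ancestral set: it contains the parents of its nodes. -/
def IsAncestral (G : Digraph V) (T : Finset V) : Prop :=
  ∀ v ∈ T, parents G v ⊆ T

theorem isAncestral_ancestors (G : Digraph V) (S : Finset V) : IsAncestral G (ancestors G S) := by
  intro v hv u hu
  obtain ⟨s, hs, hvs⟩ := mem_ancestors.1 hv
  exact mem_ancestors.2 ⟨s, hs, .head (mem_parents.1 hu) hvs⟩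

variable [DecidableEq V]

/-- The family of `i`: the nodes that enter its conditional density given its parents. -/
noncomputable def family (G : Digraph V) (i : V) : Finset V :=
  insert i (parents G i)

/-- `P` contains the boundary of `B` in the moral graph of `T`, in which any two nodes of a common
family are joined. -/
def IsMoralBoundary (G : Digraph V) (T B P : Finset V) : Prop :=
  ∀ i ∈ T, ¬ Disjoint (family G i) B → family G i ⊆ B ∪ P

namespace IsOpenWalk

variable {i b u : V} {l : List V}

theorem exists_of_mem_family (hG : IsAcyclic G) {v : V} {p : List V} (h : IsOpenWalk G C v b p)
    (hvC : v ∉ C) (hv : v ∈ family G i) :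
    ∃ l, IsOpenWalk G C i b (i :: l) ∧ (i ∈ C → ∀ t ∈ l.head?, G.Adj t i) := by
  obtain ⟨l, rfl⟩ := h.exists_eq_cons
  rcases Finset.mem_insert.1 hv with rfl | hv
  · exact ⟨l, h, fun hi => absurd hi hvC⟩
  · have hvi : G.Adj v i := mem_parents.1 hv
    refine ⟨v :: l, h.cons (Or.inr hvi) fun t _ => isOpenAt_of_adj_left hG hvi hvC, fun _ => ?_⟩
    simpa using hvi

/- If `i` is an ancestor of `C`, it is passed as a collider. Otherwise one descends from `i` to
`A ∪ B`: reaching `A` contradicts the separation, and reaching `B` gives a directed walk that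
starts at the parent `u`. -/
theorem exists_of_adj (hG : IsAcyclic G) (hsep : DSep G A B C)
    (h : IsOpenWalk G C i b (i :: l)) (hb : b ∈ B) (hl : i ∈ C → ∀ t ∈ l.head?, G.Adj t i)
    (hi : i ∈ ancestors G (A ∪ B ∪ C)) (hu : G.Adj u i) :
    ∃ b ∈ B, ∃ q, IsOpenWalk G C u b q := by
  by_cases hiC : ∃ d ∈ C, IsAncestor G i d
  · refine ⟨b, hb, _, h.cons (Or.inl hu) fun t ht => ⟨fun _ => hiC, fun hc hi => ?_⟩⟩
    exact hc ⟨hu, hl hi t ht⟩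
  push Not at hiC
  obtain ⟨d, hd, hid⟩ := mem_ancestors.1 hi
  rcases Finset.mem_union.1 hd with hd | hd
  · rcases Finset.mem_union.1 hd with hd | hd
    · obtain ⟨q, hq⟩ := h.exists_of_isAncestor hG hid hiC
      exact absurd hq (hsep.not_isOpenWalk hG hd hb q)
    · obtain ⟨q, hq⟩ := ((singleton u).cons (Or.inr hu) (by simp)).exists_of_isAncestor hG hid hiC
      exact ⟨d, hd, _, hq.reverse⟩
  · exact absurd hid (hiC d hd)

end IsOpenWalk

theorem DSep.exists_isMoralBoundary (hG : IsAcyclic G) (hBC : Disjoint B C) (h : DSep G A B C) :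
    ∃ S ⊆ ancestors G (A ∪ B ∪ C), B ⊆ S ∧ Disjoint S (A ∪ C) ∧
      IsMoralBoundary G (ancestors G (A ∪ B ∪ C)) S C := by
  classical
  set T := ancestors G (A ∪ B ∪ C)
  have hBT : B ⊆ T := fun b hb => subset_ancestors _ _ (by simp [hb])
  refine ⟨T.filter fun v => v ∉ C ∧ ∃ b ∈ B, ∃ p, IsOpenWalk G C v b p, Finset.filter_subset _ _,
    fun b hb => Finset.mem_filter.2 ⟨hBT hb, Finset.disjoint_left.1 hBC hb, b, hb, _,
      IsOpenWalk.singleton b⟩, ?_, ?_⟩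
  · simp only [Finset.disjoint_left, Finset.mem_filter, Finset.mem_union, not_or]
    rintro v ⟨-, hvC, b, hb, p, hp⟩
    exact ⟨fun hvA => h.not_isOpenWalk hG hvA hb p hp, hvC⟩
  · intro i hi hdisj u hu
    obtain ⟨v, hvi, hv⟩ := Finset.not_disjoint_iff.1 hdisj
    obtain ⟨-, hvC, b, hb, p, hp⟩ := Finset.mem_filter.1 hv
    obtain ⟨l, hl, hil⟩ := hp.exists_of_mem_family hG hvC hvi
    by_cases huC : u ∈ C
    · exact Finset.mem_union_right _ huC
    refine Finset.mem_union_left _ (Finset.mem_filter.2 ?_)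
    rcases Finset.mem_insert.1 hu with rfl | hui
    · exact ⟨hi, huC, b, hb, _, hl⟩
    · exact ⟨isAncestral_ancestors _ _ i hi hui, huC,
        hl.exists_of_adj hG h hb hil hi (mem_parents.1 hui)⟩

end Separation

section Backdoor

variable {V : Type*} {G : Digraph V} {C D X Z : Finset V} {a b w x y : V} {p q : List V}

/-- The graph `G` without the edges leaving `X`, in which the paths from `X` are the back-door
paths of `G`. -/
def deleteOutEdges (G : Digraph V) (X : Finset V) : Digraph V where
  Adj u v := G.Adj u v ∧ u ∉ X

theorem deleteOutEdges_empty (G : Digraph V) : deleteOutEdges G ∅ = G := by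
  ext; simp [deleteOutEdges]

theorem IsAcyclic.deleteOutEdges (hG : IsAcyclic G) (X : Finset V) :
    IsAcyclic (deleteOutEdges G X) :=
  fun v h => hG v (Relation.TransGen.mono (fun _ _ h => h.1) _ _ h)

theorem IsAncestor.of_deleteOutEdges (h : IsAncestor (deleteOutEdges G X) a b) : IsAncestor G a b :=
  Relation.ReflTransGen.mono (fun _ _ h => h.1) _ _ h

theorem IsOpenWalk.of_deleteOutEdges (hG : IsAcyclic G)
    (h : IsOpenWalk (deleteOutEdges G X) Z a b p) (hZD : Z ⊆ D) (hD : ∀ v ∈ D, v ∈ Z ∨ v ∈ X) :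
    IsOpenWalk G D a b p := by
  refine ⟨h.chain.imp fun _ _ => Or.imp And.left And.left, h.head, h.last, fun s m t hsmt => ?_⟩
  have hadj := h.chain.infix hsmt
  simp only [List.isChain_cons_cons, List.isChain_singleton, and_true] at hadj
  constructor
  · rintro ⟨hs, ht⟩
    obtain ⟨d, hd, hmd⟩ := (h.isOpen s m t hsmt).1
      ⟨hadj.1.resolve_right fun h => hG.not_adj hs h.1,
        hadj.2.resolve_left fun h => hG.not_adj ht h.1⟩
    exact ⟨d, hZD hd, hmd.of_deleteOutEdges⟩
  · intro hcol hm
    rcases hD m hm with hmZ | hmX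
    · exact (h.isOpen s m t hsmt).2 (fun h' => hcol ⟨h'.1.1, h'.2.1⟩) hmZ
    · exact hcol ⟨(hadj.1.resolve_right fun h => h.2 hmX).1,
        (hadj.2.resolve_left fun h => h.2 hmX).1⟩

section Blocking

variable [DecidableEq V]

/- A node whose addition to the conditioning set blocks an open path is a non-collider on it; an
edge of the path leaving `x` starts a directed walk, which can only lead to `y`. -/
theorem exists_isOpenWalk_of_dSep_insert (hdep : ¬ DSep G {w} {y} C)
    (hind : DSep G {w} {y} (insert x C)) (hx : ∀ d ∈ insert w C, ¬ IsAncestor G x d) :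
    HasCausalEffect G x y ∧
      ∃ l s, IsOpenWalk G (insert x C) w x (l ++ [s, x]) ∧ G.Adj s x := by
  simp only [DSep, Finset.mem_singleton, forall_eq, not_forall, not_not] at hdep hind
  obtain ⟨p, hp, hpC⟩ := hdep
  obtain ⟨s, m, t, hsmt, hm⟩ : ∃ s m t, [s, m, t] <:+: p ∧ ¬ IsOpenAt G (insert x C) s m t := by
    by_contra! h
    exact hind p hp h
  obtain ⟨rfl, hcol⟩ := IsOpenAt.eq_of_not_isOpenAt_insert (hpC s m t hsmt) hm
  have hxC : ∀ d ∈ C, ¬ IsAncestor G m d := fun d hd => hx d (Finset.mem_insert_of_mem hd)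
  obtain ⟨l₁, l₂, rfl⟩ := hsmt
  have hwalk : IsOpenWalk G C w y ((l₁ ++ [s]) ++ m :: t :: l₂) := by
    simpa using hp.isOpenWalk hpC
  have hleft : IsOpenWalk G C w m (l₁ ++ [s] ++ [m]) := hwalk.left_of_append
  have hright : IsOpenWalk G C m y (m :: t :: l₂) := hwalk.right_of_append
  have hrev : IsOpenWalk G C m w (m :: s :: l₁.reverse) := by simpa using hleft.reverse
  have hsm : G.Adj s m := (List.isChain_cons_cons.1 hrev.chain).1.resolve_left fun hms =>
    hx w (by simp) (hrev.transGen_of_adj hms hxC).to_reflTransGen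
  have hmt : G.Adj m t := (List.isChain_cons_cons.1 hright.chain).1.resolve_right fun htm =>
    hcol ⟨hsm, htm⟩
  have hnd : (l₁ ++ [s] ++ [m]).Nodup := hp.nodup.sublist (List.IsPrefix.sublist ⟨t :: l₂, by simp⟩)
  refine ⟨hright.transGen_of_adj hmt hxC, l₁, s, ?_, hsm⟩
  have hx : IsOpenWalk G (insert m C) w m (l₁ ++ [s] ++ [m]) :=
    { hleft with isOpen := hleft.isOpen.insert_of_nodup hnd }
  simpa using hx

/- A back-door walk from `x` enters `x`, so that `x` is an open collider on its concatenation with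
the open walk from `w` to `x`. -/
theorem not_isOpenWalk_deleteOutEdges_of_dSep_insert (hG : IsAcyclic G) (hdep : ¬ DSep G {w} {y} C)
    (hind : DSep G {w} {y} (insert x C)) (hx : ∀ d ∈ insert w C, ¬ IsAncestor G x d)
    (hxX : x ∈ X) (hZC : Z ⊆ C) (hC : ∀ v ∈ C, v ∈ Z ∨ v ∈ X) (q : List V) :
    ¬ IsOpenWalk (deleteOutEdges G X) Z x y q := by
  intro hq
  obtain ⟨hxy, l, s, hws, hsx⟩ := exists_isOpenWalk_of_dSep_insert hdep hind hx
  obtain ⟨q, rfl⟩ := hq.exists_eq_cons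
  rcases q with _ | ⟨t, q⟩
  · obtain rfl : x = y := by simpa using hq.last
    exact hG x hxy
  have htx : G.Adj t x :=
    ((List.isChain_cons_cons.1 hq.chain).1.resolve_left fun h => h.2 hxX).1
  have hqG : IsOpenWalk G (insert x C) x y (x :: t :: q) :=
    hq.of_deleteOutEdges hG (hZC.trans (Finset.subset_insert _ _))
      (Finset.forall_mem_insert _ _ _ |>.2 ⟨Or.inr hxX, hC⟩)
  exact hind.not_isOpenWalk hG (by simp) (by simp) _
    (hws.append hqG (isOpenAt_of_adj hsx htx ⟨x, by simp, .refl⟩))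

theorem dSep_deleteOutEdges_of_forall_dSep_insert {ι : Type*} [Fintype ι] (hG : IsAcyclic G)
    {x w : ι → V} {C : ι → Finset V} (hZC : ∀ i, Z ⊆ C i)
    (hC : ∀ i, C i ⊆ Z ∪ Finset.univ.image x) (hdep : ∀ i, ¬ DSep G {w i} {y} (C i))
    (hind : ∀ i, DSep G {w i} {y} (insert (x i) (C i)))
    (hx : ∀ i, ∀ d ∈ insert (w i) (C i), ¬ IsAncestor G (x i) d) :
    DSep (deleteOutEdges G (Finset.univ.image x)) (Finset.univ.image x) {y} Z := by
  simp only [DSep, Finset.mem_image, Finset.mem_univ, true_and, Finset.mem_singleton,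
    forall_exists_index, forall_apply_eq_imp_iff, forall_eq]
  exact fun i q hq hqo => not_isOpenWalk_deleteOutEdges_of_dSep_insert hG (hdep i) (hind i) (hx i)
    (by simp) (hZC i) (fun v hv => Finset.mem_union.1 (hC i hv)) q (hq.isOpenWalk hqo)

end Blocking

variable [Fintype V]

section Transfer

variable {S T : Finset V}

theorem IsAncestral.of_deleteOutEdges (h : IsAncestral (deleteOutEdges G X) T) (hXT : X ⊆ T) :
    IsAncestral G T := by
  intro v hv u hu
  by_cases huX : u ∈ X
  · exact hXT huX
  · exact h v hv (mem_parents.2 ⟨mem_parents.1 hu, huX⟩)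

variable [DecidableEq V]

theorem mem_family_deleteOutEdges {i u : V} (hu : u ∈ family G i) (huX : u ∉ X) :
    u ∈ family (deleteOutEdges G X) i := by
  rcases Finset.mem_insert.1 hu with rfl | hu
  · exact Finset.mem_insert_self _ _
  · exact Finset.mem_insert_of_mem (mem_parents.2 ⟨mem_parents.1 hu, huX⟩)

theorem IsMoralBoundary.of_deleteOutEdges (h : IsMoralBoundary (deleteOutEdges G X) T S Z)
    (hXS : Disjoint X S) : IsMoralBoundary G T S (X ∪ Z) := by
  intro i hi hiS u hu
  obtain ⟨v, hv, hvS⟩ := Finset.not_disjoint_iff.1 hiS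
  have hv' := mem_family_deleteOutEdges hv (Finset.disjoint_right.1 hXS hvS)
  by_cases huX : u ∈ X
  · simp [huX]
  · have := h i hi (Finset.not_disjoint_iff.2 ⟨v, hv', hvS⟩) (mem_family_deleteOutEdges hu huX)
    grind

theorem IsMoralBoundary.disjoint_family_of_deleteOutEdges
    (h : IsMoralBoundary (deleteOutEdges G X) T S Z) (hXT : X ⊆ T) (hXS : Disjoint X S)
    (hXZ : Disjoint X Z) : ∀ i ∈ X, Disjoint (family G i) S := by
  intro i hi
  by_contra hiS
  obtain ⟨v, hv, hvS⟩ := Finset.not_disjoint_iff.1 hiS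
  have hv' := mem_family_deleteOutEdges hv (Finset.disjoint_right.1 hXS hvS)
  rcases Finset.mem_union.1 (h i (hXT hi) (Finset.not_disjoint_iff.2 ⟨v, hv', hvS⟩)
    (Finset.mem_insert_self _ _)) with hi' | hi'
  · exact Finset.disjoint_left.1 hXS hi hi'
  · exact Finset.disjoint_left.1 hXZ hi hi'

end Transfer

end Backdoor

section Marginals

variable {V : Type*} {E : V → Type u} {f g : (∀ v, E v) → ℝ≥0∞} {s t : Set V} {S T : Finset V}

theorem dependsOn_finset_prod {ι : Type*} {f : ι → (∀ v, E v) → ℝ≥0∞} {J : Finset ι}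
    (h : ∀ i ∈ J, DependsOn (f i) s) : DependsOn (∏ i ∈ J, f i) s := by
  intro x y hxy
  simp only [Finset.prod_apply]
  exact Finset.prod_congr rfl fun i hi => h i hi hxy

variable [DecidableEq V] [∀ v, MeasurableSpace (E v)] {μ : ∀ v, Measure (E v)}

theorem dependsOn_lmarginal (h : DependsOn f s) (S : Finset V) :
    DependsOn (∫⋯∫⁻_S, f ∂μ) (s \ S) := by
  intro x y hxy
  refine lintegral_congr fun z => h fun i hi => ?_
  by_cases hS : i ∈ S
  · simp [Function.updateFinset, hS]
  · simpa [Function.updateFinset, hS] using hxy i ⟨hi, hS⟩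

theorem lmarginal_mul_of_dependsOn (hf : DependsOn f s) (hg : Measurable g) (hsS : Disjoint s S) :
    ∫⋯∫⁻_S, f * g ∂μ = f * ∫⋯∫⁻_S, g ∂μ := by
  funext x
  have hx (y) : f (Function.updateFinset x S y) = f x := hf fun i hi => by
    have hiS : i ∉ S := Set.disjoint_left.1 hsS hi
    simp [Function.updateFinset, hiS]
  simp only [lmarginal, Pi.mul_apply, hx]
  exact lintegral_const_mul _ (hg.comp measurable_updateFinset)

variable [∀ v, SigmaFinite (μ v)]

theorem lmarginal_union_mul (hf : DependsOn f s) (hg : DependsOn g t) (hfm : Measurable f)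
    (hgm : Measurable g) (hST : Disjoint S T) (hsT : Disjoint s T) (htS : Disjoint t S) :
    ∫⋯∫⁻_(S ∪ T), f * g ∂μ = (∫⋯∫⁻_S, f ∂μ) * ∫⋯∫⁻_T, g ∂μ := by
  rw [lmarginal_union μ _ (hfm.mul hgm) hST, lmarginal_mul_of_dependsOn hf hgm hsT, mul_comm f,
    lmarginal_mul_of_dependsOn (dependsOn_lmarginal hg T) hfm (htS.mono_left Set.sdiff_subset),
    mul_comm]

variable [Fintype V]

theorem measurePreserving_piEquivPiSubtypeProd_mem (μ : ∀ v, Measure (E v))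
    [∀ v, SigmaFinite (μ v)] (S : Finset V) :
    MeasurePreserving (MeasurableEquiv.piEquivPiSubtypeProd E (· ∈ S)) (Measure.pi μ)
      ((Measure.pi fun i : S => μ i).prod (Measure.pi fun i : {i // i ∉ S} => μ i)) := by
  convert measurePreserving_piEquivPiSubtypeProd μ (· ∈ S)

/- With `e` the equivalence above, `updateFinset x S y` is `e.symm (y, (e x).2)` by definition. -/
theorem ae_ae_updateFinset {p : (∀ v, E v) → Prop} (h : ∀ᵐ x ∂Measure.pi μ, p x) (S : Finset V) :
    ∀ᵐ x ∂Measure.pi μ, ∀ᵐ y ∂Measure.pi fun i : S => μ i, p (Function.updateFinset x S y) := by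
  have he := measurePreserving_piEquivPiSubtypeProd_mem μ S
  have hprod := (he.symm.comp Measure.measurePreserving_swap).quasiMeasurePreserving.ae h
  exact (Measure.quasiMeasurePreserving_snd.comp he.quasiMeasurePreserving).ae
    (Measure.ae_ae_of_ae_prod hprod)

theorem lmarginal_congr_ae (h : f =ᵐ[Measure.pi μ] g) (S : Finset V) :
    ∫⋯∫⁻_S, f ∂μ =ᵐ[Measure.pi μ] ∫⋯∫⁻_S, g ∂μ := by
  filter_upwards [ae_ae_updateFinset h S] with x hx
  exact lintegral_congr_ae hx

theorem lmarginal_lt_top_ae (hf : Measurable f) (h : ∫⁻ x, f x ∂Measure.pi μ ≠ ∞) (S : Finset V) :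
    ∀ᵐ x ∂Measure.pi μ, (∫⋯∫⁻_S, f ∂μ) x < ∞ := by
  have he := measurePreserving_piEquivPiSubtypeProd_mem μ S
  have hfe := hf.comp he.symm.measurable
  rw [← he.symm.lintegral_comp hf] at h
  exact (Measure.quasiMeasurePreserving_snd.comp he.quasiMeasurePreserving).ae
    (ae_lt_top hfe.lintegral_prod_left' ((lintegral_prod_symm' _ hfe).symm.trans_ne h))

theorem lmarginal_pos_ae (hf : Measurable f) (h : ∀ᵐ x ∂Measure.pi μ, 0 < f x) (S : Finset V) :
    ∀ᵐ x ∂Measure.pi μ, 0 < (∫⋯∫⁻_S, f ∂μ) x := by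
  have hS : Measure.pi (fun i : S => μ i) = 0 → Measure.pi μ = 0 := fun h0 => by
    have hprod := (measurePreserving_piEquivPiSubtypeProd_mem μ S).map_eq
    rwa [h0, Measure.zero_prod, Measure.map_eq_zero_iff (by fun_prop)] at hprod
  rcases eq_or_ne (Measure.pi μ) 0 with hμ | hμ
  · simp [hμ]
  have : (ae (Measure.pi fun i : S => μ i)).NeBot := ae_neBot.2 (mt hS hμ)
  filter_upwards [ae_ae_updateFinset h S] with x hx
  refine pos_iff_ne_zero.2 fun h0 => ?_
  obtain ⟨y, hy, hy0⟩ :=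
    (hx.and ((lintegral_eq_zero_iff (hf.comp measurable_updateFinset)).1 h0)).exists
  exact hy.ne' hy0

end Marginals

section Factorization

variable {V : Type*} [Fintype V] [DecidableEq V] {E : V → Type u} [∀ v, MeasurableSpace (E v)]
  {μ : ∀ v, Measure (E v)} {f : (∀ v, E v) → ℝ≥0∞} {G : Digraph V} {A B I J P R S T : Finset V}

theorem dependsOn_marg (S : Finset V) : DependsOn (marg μ f S) S :=
  (dependsOn_lmarginal (dependsOn_univ f) Sᶜ).mono (by simp)

/-- The factor `f(v_i | pa(v_i))` of the Markov factorization of `f` along `G`. -/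
noncomputable def markovFactor (G : Digraph V) (μ : ∀ v, Measure (E v)) (f : (∀ v, E v) → ℝ≥0∞)
    (i : V) : (∀ v, E v) → ℝ≥0∞ :=
  condDens μ f {i} (parents G i)

theorem dependsOn_markovFactor (i : V) : DependsOn (markovFactor G μ f i) (family G i) := by
  intro x y hxy
  have hfam : marg μ f ({i} ∪ parents G i) x = marg μ f ({i} ∪ parents G i) y :=
    dependsOn_marg _ hxy
  have hpar : marg μ f (parents G i) x = marg μ f (parents G i) y :=
    dependsOn_marg _ fun j hj => hxy j (Finset.mem_insert_of_mem hj)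
  simp only [markovFactor, condDens, hfam, hpar]

theorem dependsOn_prod_markovFactor {s : Set V} (h : ∀ i ∈ J, (family G i : Set V) ⊆ s) :
    DependsOn (∏ i ∈ J, markovFactor G μ f i) s :=
  dependsOn_finset_prod fun i hi => (dependsOn_markovFactor i).mono (h i hi)

variable [∀ v, SigmaFinite (μ v)]

theorem measurable_marg (hf : Measurable f) (S : Finset V) : Measurable (marg μ f S) :=
  hf.lmarginal μ

theorem measurable_markovFactor (hf : Measurable f) (i : V) : Measurable (markovFactor G μ f i) :=
  (measurable_marg hf _).div (measurable_marg hf _)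

theorem measurable_prod_markovFactor (hf : Measurable f) (J : Finset V) :
    Measurable (∏ i ∈ J, markovFactor G μ f i) := by
  rw [Finset.prod_fn]
  exact Finset.measurable_prod J fun i _ => measurable_markovFactor hf i

theorem lmarginal_marg_union (hf : Measurable f) (hAB : Disjoint A B) :
    ∫⋯∫⁻_A, marg μ f (A ∪ B) ∂μ = marg μ f B := by
  have hB : Bᶜ = A ∪ (A ∪ B)ᶜ := by
    grind [Finset.mem_compl, Finset.disjoint_left]
  rw [marg, marg, hB, lmarginal_union μ f hf (by grind [Finset.mem_compl, Finset.disjoint_left])]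

theorem lmarginal_condDens (hf : Measurable f) (hpos : ∀ᵐ x ∂Measure.pi μ, 0 < f x)
    (hfin : ∫⁻ x, f x ∂Measure.pi μ ≠ ∞) (hAB : Disjoint A B) :
    ∫⋯∫⁻_A, condDens μ f A B ∂μ =ᵐ[Measure.pi μ] 1 := by
  have hdiv : condDens μ f A B = (marg μ f B)⁻¹ * marg μ f (A ∪ B) := by
    funext x
    simp [condDens, ENNReal.div_eq_inv_mul]
  have hdep : DependsOn (marg μ f B)⁻¹ B := fun x y hxy => congrArg (·⁻¹) (dependsOn_marg B hxy)
  rw [hdiv, lmarginal_mul_of_dependsOn hdep (measurable_marg hf _)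
    (Finset.disjoint_coe.2 hAB.symm), lmarginal_marg_union hf hAB]
  filter_upwards [lmarginal_pos_ae hf hpos Bᶜ, lmarginal_lt_top_ae hf hfin Bᶜ] with x hx hx'
  exact ENNReal.inv_mul_cancel hx.ne' hx'.ne

/- A source `s` of `S` is integrated last: then the factor of `s` is the only one left that depends
on `s`, and its integral is `1`. -/
theorem lmarginal_prod_markovFactor (hG : IsAcyclic G) (hf : Measurable f)
    (hpos : ∀ᵐ x ∂Measure.pi μ, 0 < f x) (hfin : ∫⁻ x, f x ∂Measure.pi μ ≠ ∞) (hSI : S ⊆ I)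
    (hS : ∀ i ∈ I \ S, Disjoint (family G i) S) :
    ∫⋯∫⁻_S, ∏ i ∈ I, markovFactor G μ f i ∂μ =ᵐ[Measure.pi μ]
      ∏ i ∈ I \ S, markovFactor G μ f i := by
  induction S using Finset.strongInduction with | H S ih
  rcases S.eq_empty_or_nonempty with rfl | hne
  · simp
  obtain ⟨s, hs, hparents⟩ := hG.exists_disjoint_parents hne
  have hI : I \ S.erase s = insert s (I \ S) := by grind
  have herase : ∫⋯∫⁻_(S.erase s), ∏ i ∈ I, markovFactor G μ f i ∂μ =ᵐ[Measure.pi μ]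
      (∏ i ∈ I \ S, markovFactor G μ f i) * markovFactor G μ f s := by
    have := ih (S.erase s) (Finset.erase_ssubset hs) ((S.erase_subset s).trans hSI) ?_
    · rwa [hI, Finset.prod_insert (by simp [hs]), mul_comm] at this
    · rw [hI, Finset.forall_mem_insert]
      refine ⟨?_, fun i hi => (hS i hi).mono_right (S.erase_subset s)⟩
      simpa [family] using hparents.mono_right (S.erase_subset s)
  have hdep : DependsOn (∏ i ∈ I \ S, markovFactor G μ f i) ({s}ᶜ : Set V) :=
    dependsOn_prod_markovFactor fun i hi j hj hjs =>
      Finset.disjoint_left.1 (hS i hi) hj (hjs ▸ hs)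
  have hs1 : ∫⋯∫⁻_{s}, markovFactor G μ f s ∂μ =ᵐ[Measure.pi μ] 1 :=
    lmarginal_condDens hf hpos hfin
      (Finset.disjoint_singleton_left.2 fun h => Finset.disjoint_left.1 hparents h hs)
  rw [← Finset.insert_erase hs, Finset.insert_eq,
    lmarginal_union μ _ (measurable_prod_markovFactor hf I) (by simp), ← Finset.insert_eq,
    Finset.insert_erase hs]
  refine (lmarginal_congr_ae herase {s}).trans ?_
  rw [lmarginal_mul_of_dependsOn hdep (measurable_markovFactor hf s)
    (by simp [Set.disjoint_left])]
  filter_upwards [hs1] with x hx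
  simp [hx]

theorem lmarginal_prod_markovFactor_eq_mul (hf : Measurable f) (hST : S ⊆ T) (hPR : P ⊆ R)
    (hJ : IsMoralBoundary G J S P) :
    ∫⋯∫⁻_(T \ R), ∏ i ∈ J, markovFactor G μ f i ∂μ =
      (∫⋯∫⁻_(S \ R), ∏ i ∈ J with ¬ Disjoint (family G i) S, markovFactor G μ f i ∂μ) *
        ∫⋯∫⁻_((T \ S) \ R), ∏ i ∈ J with Disjoint (family G i) S, markovFactor G μ f i ∂μ := by
  have hTR : T \ R = (S \ R) ∪ ((T \ S) \ R) := by
    rw [← Finset.union_sdiff_distrib, Finset.union_sdiff_of_subset hST]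
  have hmeet : DependsOn (∏ i ∈ J with ¬ Disjoint (family G i) S, markovFactor G μ f i)
      (S ∪ P : Set V) :=
    dependsOn_prod_markovFactor fun i hi => by
      obtain ⟨hiJ, hiS⟩ := Finset.mem_filter.1 hi
      exact_mod_cast hJ i hiJ hiS
  have hmiss : DependsOn (∏ i ∈ J with Disjoint (family G i) S, markovFactor G μ f i)
      ((S : Set V)ᶜ) :=
    dependsOn_prod_markovFactor fun i hi =>
      Set.subset_compl_iff_disjoint_right.2 (Finset.disjoint_coe.2 (Finset.mem_filter.1 hi).2)
  rw [hTR, ← Finset.prod_filter_not_mul_prod_filter J fun i => Disjoint (family G i) S]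
  refine lmarginal_union_mul hmeet hmiss (measurable_prod_markovFactor hf _)
    (measurable_prod_markovFactor hf _) ?_ ?_ ?_
  · grind [Finset.disjoint_left]
  · rw [Set.disjoint_left]
    rintro i (hi | hi) hi' <;> grind
  · exact Set.disjoint_left.2 fun i hi hi' => hi (Finset.mem_sdiff.1 hi').1

end Factorization

section Models

variable {V : Type*} [Fintype V] [DecidableEq V] {E : V → Type u} [∀ v, MeasurableSpace (E v)]
  {μ : ∀ v, Measure (E v)} {G : Digraph V} {F : InterventionalFamily μ}
  {A B C P S T X Y Z : Finset V}

theorem IsCompatible.dens_ae_eq (hF : IsCompatible G F) (X : Finset V) :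
    F.dens X =ᵐ[Measure.pi μ] ∏ i ∈ Xᶜ, markovFactor G μ F.obs i := by
  filter_upwards [hF X] with v hv
  rw [hv, Finset.prod_apply]
  rfl

namespace InterventionalFamily

theorem doDens_empty (F : InterventionalFamily μ) (Y : Finset V) :
    F.doDens ∅ Y = marg μ F.obs Y := by
  rw [doDens, Finset.empty_union]
  rfl

variable [∀ v, SigmaFinite (μ v)]

theorem lintegral_obs_ne_top (F : InterventionalFamily μ) :
    ∫⁻ v, F.obs v ∂Measure.pi μ ≠ ∞ := by
  rcases isEmpty_or_nonempty (∀ v, E v) with hE | ⟨⟨x⟩⟩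
  · simp
  · rw [lintegral_eq_lmarginal_univ x]
    simpa [obs] using (F.normalized ∅ x).trans_ne ENNReal.one_ne_top

theorem marg_obs_pos_ae (F : InterventionalFamily μ) (S : Finset V) :
    ∀ᵐ v ∂Measure.pi μ, 0 < marg μ F.obs S v :=
  lmarginal_pos_ae (F.measurable_dens ∅) F.pos Sᶜ

theorem marg_obs_lt_top_ae (F : InterventionalFamily μ) (S : Finset V) :
    ∀ᵐ v ∂Measure.pi μ, marg μ F.obs S v < ∞ :=
  lmarginal_lt_top_ae (F.measurable_dens ∅) F.lintegral_obs_ne_top Sᶜ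

end InterventionalFamily

theorem isIdentifiable (G : Digraph V) (X Y : Finset V) : IsIdentifiable.{u} G X Y := by
  intro E _ μ _ F₁ F₂ h₁ h₂ hobs
  have hmarg : ∀ᵐ v ∂Measure.pi μ, ∀ S, marg μ F₁.obs S v = marg μ F₂.obs S v :=
    ae_all_iff.2 fun S => lmarginal_congr_ae hobs Sᶜ
  refine lmarginal_congr_ae ?_ _
  filter_upwards [h₁ X, h₂ X, hmarg] with v hv₁ hv₂ hv
  simp only [hv₁, hv₂, condDens, hv]

variable [∀ v, SigmaFinite (μ v)]

theorem IsCompatible.doDens_ae_eq (hF : IsCompatible G F) (hG : IsAcyclic G) (hT : IsAncestral G T)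
    (hYT : Y ⊆ T) :
    F.doDens X Y =ᵐ[Measure.pi μ]
      ∫⋯∫⁻_(T \ (X ∪ Y)), ∏ i ∈ T \ X, markovFactor G μ F.obs i ∂μ := by
  have hobs : Measurable F.obs := F.measurable_dens ∅
  have hcompl : (X ∪ Y)ᶜ = (T \ (X ∪ Y)) ∪ (Xᶜ \ T) := by grind [Finset.mem_compl]
  have hTX : Xᶜ \ (Xᶜ \ T) = T \ X := by grind [Finset.mem_compl]
  have hfam : ∀ i ∈ Xᶜ \ (Xᶜ \ T), Disjoint (family G i) (Xᶜ \ T) := fun i hi => by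
    rw [hTX] at hi
    have hiT := (Finset.mem_sdiff.1 hi).1
    exact (Finset.sdiff_disjoint (t := Xᶜ)).symm.mono_left (Finset.insert_subset hiT (hT i hiT))
  have houter := lmarginal_prod_markovFactor hG hobs F.pos F.lintegral_obs_ne_top
    Finset.sdiff_subset hfam
  rw [hTX] at houter
  refine (lmarginal_congr_ae (hF.dens_ae_eq X) _).trans ?_
  rw [hcompl, lmarginal_union μ _ (measurable_prod_markovFactor hobs _)
    (by grind [Finset.mem_compl, Finset.disjoint_left])]
  exact lmarginal_congr_ae houter _

theorem IsCompatible.doDens_ae_eq_marg_obs (hF : IsCompatible G F) (hG : IsAcyclic G)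
    (hanc : ∀ x ∈ X, ∀ z ∈ Z, ¬ IsAncestor G x z) :
    F.doDens X Z =ᵐ[Measure.pi μ] marg μ F.obs Z := by
  have hdisj : Disjoint (ancestors G Z) X := Finset.disjoint_left.2 fun i hi hiX =>
    let ⟨z, hz, hiz⟩ := mem_ancestors.1 hi
    hanc i hiX z hz hiz
  have hT := isAncestral_ancestors G Z
  have hZT := subset_ancestors G Z
  have hdo := hF.doDens_ae_eq (X := X) hG hT hZT
  have hobs := hF.doDens_ae_eq (X := ∅) hG hT hZT
  rw [Finset.sdiff_empty, Finset.empty_union, F.doDens_empty] at hobs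
  rw [Finset.sdiff_union_distrib, Finset.sdiff_eq_self_of_disjoint hdisj,
    Finset.inter_eq_right.2 Finset.sdiff_subset] at hdo
  exact hdo.trans hobs.symm

theorem IsCompatible.doDens_union_ae_eq_mul (hF : IsCompatible G F) (hG : IsAcyclic G)
    (hT : IsAncestral G T) (hST : S ⊆ T) (hS : IsMoralBoundary G T S P)
    (hX : ∀ i ∈ X, Disjoint (family G i) S) (hPXZ : P ⊆ X ∪ Z) (hXZS : Disjoint (X ∪ Z) S)
    (hYS : Y ⊆ S) (hZT : Z ⊆ T) :
    F.doDens X (Y ∪ Z) =ᵐ[Measure.pi μ]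
      (∫⋯∫⁻_(S \ Y), ∏ i ∈ T with ¬ Disjoint (family G i) S, markovFactor G μ F.obs i ∂μ) *
        ∫⋯∫⁻_((T \ S) \ (X ∪ Z)),
          ∏ i ∈ T \ X with Disjoint (family G i) S, markovFactor G μ F.obs i ∂μ := by
  have hmul := lmarginal_prod_markovFactor_eq_mul (μ := μ) (R := X ∪ (Y ∪ Z))
    (F.measurable_dens ∅) hST (hPXZ.trans (by grind)) fun i (hi : i ∈ T \ X) =>
      hS i (Finset.mem_sdiff.1 hi).1
  have hSR : S \ (X ∪ (Y ∪ Z)) = S \ Y := by grind [Finset.disjoint_left]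
  have hTR : (T \ S) \ (X ∪ (Y ∪ Z)) = (T \ S) \ (X ∪ Z) := by grind
  have hmeet : {i ∈ T \ X | ¬ Disjoint (family G i) S} = {i ∈ T | ¬ Disjoint (family G i) S} := by
    grind
  rw [hSR, hTR, hmeet] at hmul
  exact (hF.doDens_ae_eq hG hT (Finset.union_subset (hYS.trans hST) hZT)).trans (.of_eq hmul)

theorem IsCompatible.marg_mul_doDens_ae_eq (hF : IsCompatible G F) (hG : IsAcyclic G) (hXA : X ⊆ A)
    (hXZ : Disjoint X Z) (hYZ : Disjoint Y Z) (h : DSep (deleteOutEdges G X) A Y Z) :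
    marg μ F.obs (A ∪ Y ∪ Z) * F.doDens X Z =ᵐ[Measure.pi μ]
      marg μ F.obs (A ∪ Z) * F.doDens X (Y ∪ Z) := by
  obtain ⟨S, hST, hYS, hSAZ, hbd⟩ := h.exists_isMoralBoundary (hG.deleteOutEdges X) hYZ
  set T := ancestors (deleteOutEdges G X) (A ∪ Y ∪ Z)
  have hAYZ : A ∪ Y ∪ Z ⊆ T := subset_ancestors _ _
  have hT : IsAncestral G T := (isAncestral_ancestors _ _).of_deleteOutEdges (by grind)
  have hXS : Disjoint X S := by grind [Finset.disjoint_left]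
  have hX : ∀ i ∈ X, Disjoint (family G i) S :=
    hbd.disjoint_family_of_deleteOutEdges (by grind) hXS hXZ
  have hbdG := hbd.of_deleteOutEdges hXS
  have hobs (R) (hR : R ⊆ S) := hF.doDens_union_ae_eq_mul (X := ∅) (Y := R) (Z := A ∪ Z) hG hT hST
    hbdG (by simp) (by grind) (by simpa using hSAZ.symm) hR (by grind)
  have hdo (R) (hR : R ⊆ S) := hF.doDens_union_ae_eq_mul (X := X) (Y := R) (Z := Z) hG hT hST
    hbdG hX subset_rfl (by grind [Finset.disjoint_left]) hR (by grind)
  simp only [F.doDens_empty, Finset.empty_union] at hobs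
  have hAYZ' : A ∪ Y ∪ Z = Y ∪ (A ∪ Z) := by grind
  rw [hAYZ']
  filter_upwards [hobs Y hYS, hobs ∅ (by simp), hdo Y hYS, hdo ∅ (by simp)] with v h₁ h₂ h₃ h₄
  rw [Finset.empty_union] at h₂ h₄
  simp only [Pi.mul_apply, h₁, h₂, h₃, h₄]
  ring

theorem IsCompatible.condIndep (hF : IsCompatible G F) (hG : IsAcyclic G) (hBC : Disjoint B C)
    (h : DSep G A B C) : CondIndep μ F.obs A B C := by
  have := hF.marg_mul_doDens_ae_eq (X := ∅) hG (by simp) (by simp) hBC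
    (by rwa [deleteOutEdges_empty])
  simp only [F.doDens_empty] at this
  exact this

theorem isAdjustmentSet_of_dSep_deleteOutEdges (hG : IsAcyclic G) (hYZ : Disjoint Y Z)
    (hanc : ∀ x ∈ X, ∀ z ∈ Z, ¬ IsAncestor G x z) (h : DSep (deleteOutEdges G X) X Y Z) :
    IsAdjustmentSet.{u} G X Y Z := by
  intro E _ μ _ F hF
  have hXZ : Disjoint X Z := Finset.disjoint_left.2 fun x hx hz => hanc x hx x hz .refl
  have hdo : F.doDens X Y = ∫⋯∫⁻_Z, F.doDens X (Y ∪ Z) ∂μ := by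
    have hcompl : (X ∪ Y)ᶜ = Z ∪ (X ∪ (Y ∪ Z))ᶜ := by
      grind [Finset.mem_compl, Finset.disjoint_left]
    rw [InterventionalFamily.doDens, hcompl,
      lmarginal_union μ _ (F.measurable_dens X)
        (by grind [Finset.mem_compl, Finset.disjoint_left])]
    rfl
  rw [hdo]
  refine lmarginal_congr_ae ?_ Z
  filter_upwards [hF.marg_mul_doDens_ae_eq hG subset_rfl hXZ hYZ h,
    hF.doDens_ae_eq_marg_obs hG hanc, F.marg_obs_pos_ae (X ∪ Z), F.marg_obs_lt_top_ae (X ∪ Z)]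
    with v hmul hZ hpos hlt
  simp only [Pi.mul_apply, hZ] at hmul
  have hunion : Y ∪ (X ∪ Z) = X ∪ Y ∪ Z := by grind
  rw [condDens, hunion, ← ENNReal.mul_div_right_comm, hmul, mul_comm,
    ENNReal.mul_div_cancel_right hpos.ne' hlt.ne]

end Models

theorem IsCausalOrdering.not_isAncestor {V : Type*} [DecidableEq V] {k : ℕ} {G : Digraph V}
    {W : Finset V} {x : Fin k → V} {L : List (Finset V)}
    (h : IsCausalOrdering G (W :: ((List.ofFn fun i => ({x i} : Finset V)) ++ L))) (i : Fin k) :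
    ∀ d ∈ W ∪ (Finset.Iio i).image x, ¬ IsAncestor G (x i) d := by
  obtain ⟨hW, hx⟩ := List.pairwise_cons.1 h
  intro d hd
  rcases Finset.mem_union.1 hd with hd | hd
  · exact hW {x i} (by simp) d hd (x i) (by simp)
  · obtain ⟨j, hj, rfl⟩ := Finset.mem_image.1 hd
    exact List.pairwise_ofFn.1 (List.pairwise_append.1 hx).1 (Finset.mem_Iio.1 hj) (x j) (by simp)
      (x i) (by simp)

end CausalDAG

theorem theorem2 {V : Type*} [Fintype V] [DecidableEq V]
    {E : V → Type u} [∀ v, MeasurableSpace (E v)]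
    (μ : ∀ v, Measure (E v)) [∀ v, SigmaFinite (μ v)]
    (M : CausalDAG.CausalModel μ)
    (k : ℕ) (hk : 1 ≤ k) (X : Fin k → V) (Y : V) (W : Finset V)
    (hXinj : Function.Injective X) (hXY : ∀ i, X i ≠ Y) (hXW : ∀ i, X i ∉ W) (hYW : Y ∉ W)
    (hord : CausalDAG.IsCausalOrdering M.graph
      (W :: ((List.ofFn fun i => ({X i} : Finset V)) ++ [{Y}])))
    (w : Fin k → V) (hw : ∀ i, w i ∈ W)
    (Z : Finset V) (hZ : Z ⊆ W \ Finset.univ.image w)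
    (hdep : ∀ i, ¬ CausalDAG.CondIndep μ M.family.obs {w i} {Y} (Z ∪ (Finset.Iio i).image X))
    (hind : ∀ i, CausalDAG.CondIndep μ M.family.obs {w i} {Y} (Z ∪ (Finset.Iic i).image X)) :
    (∀ i, CausalDAG.HasCausalEffect M.graph (X i) Y) ∧
      CausalDAG.IsIdentifiable.{u} M.graph (Finset.univ.image X) {Y} ∧
      CausalDAG.IsAdjustmentSet.{u} M.graph (Finset.univ.image X) {Y} Z := by
  set C : Fin k → Finset V := fun i => Z ∪ (Finset.Iio i).image X
  have hZW : Z ⊆ W := hZ.trans Finset.sdiff_subset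
  have hYC (s : Finset (Fin k)) : Disjoint {Y} (Z ∪ s.image X) := by
    simpa [hXY] using fun h => hYW (hZW h)
  have hwC (i) (s : Finset (Fin k)) : Disjoint {w i} (Z ∪ s.image X) := by
    have hwZ : w i ∉ Z := fun h => by simpa using hZ h
    simpa [hwZ] using fun j _ (h : X j = w i) => hXW j (h ▸ hw i)
  have hwY (i) : Disjoint {w i} ({Y} : Finset V) := by
    simpa using fun h : w i = Y => hYW (h ▸ hw i)
  have hdsep (i) : ¬ CausalDAG.DSep M.graph {w i} {Y} (C i) :=
    mt (M.compatible.condIndep M.acyclic (hYC _)) (hdep i)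
  have hdsep' (i) : CausalDAG.DSep M.graph {w i} {Y} (insert (X i) (C i)) := by
    rw [← Finset.union_insert, ← Finset.image_insert, Finset.Iio_insert]
    exact M.faithful _ _ _ (hwY i) (hwC i _) (hYC _) (hind i)
  have hanc (i) : ∀ d ∈ insert (w i) (C i), ¬ CausalDAG.IsAncestor M.graph (X i) d := fun d hd =>
    hord.not_isAncestor i d (by grind)
  have hbackdoor := CausalDAG.dSep_deleteOutEdges_of_forall_dSep_insert M.acyclic
    (fun i => Finset.subset_union_left)
    (fun i => Finset.union_subset_union_right (Finset.image_subset_image (Finset.subset_univ _)))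
    hdsep hdsep' hanc
  refine ⟨fun i => (CausalDAG.exists_isOpenWalk_of_dSep_insert (hdsep i) (hdsep' i) (hanc i)).1,
    CausalDAG.isIdentifiable _ _ _,
    CausalDAG.isAdjustmentSet_of_dSep_deleteOutEdges M.acyclic (by simpa using hYC ∅) ?_ hbackdoor⟩
  simpa using fun i z hz => hord.not_isAncestor i z (Finset.mem_union_left _ (hZW hz))
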